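/- Let $G$ be a group acting by automorphisms on a tree $T$ (a nonempty connected graph without cycles, of arbitrary cardinality, not necessarily locally finite; inversions of edges are allowed). An end of $T$ is an equivalence class of rays (infinite injective paths $x_0,x_1,\dots$ of adjacent vertices), two rays being equivalent if they have a common tail. Assume that $G$ fixes no vertex of $T$, leaves no edge of $T$ invariant (as an unoriented edge), fixes no end of $T$, and leaves no set of two distinct ends of $T$ invariant. Then $T$ has a smallest nonempty $G$-invariant subtree $T_0$, that is, a nonempty $G$-invariant subtree contained in every nonempty $G$-invariant subtree of $T$, and $$m(G_x)=1$$ for every mean $m$ on $G$ that is invariant under conjugation and every vertex $x$ of $T_0$. Here a mean on $G$ is a finitely additive probability measure defined on all subsets of $G$, it is invariant under conjugation if $m(gAg^{-1})=m(A)$ for all $g\in G$ and $A\subseteq G$, and $G_x=\{g\in G: gx=x\}$ is the stabilizer of $x$. -/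

import Mathlib

universe u v

/-- A mean on a set `X`: a finitely additive probability measure defined on all subsets of `X`. -/
structure Mean (X : Type u) where
  toFun : Set X → ℝ
  nonneg : ∀ A : Set X, 0 ≤ toFun A
  univ : toFun Set.univ = 1
  union : ∀ A B : Set X, Disjoint A B → toFun (A ∪ B) = toFun A + toFun B

/-- A mean on a group is conjugation invariant if `m (g A g⁻¹) = m A` for all `g` and `A`. -/
def Mean.ConjInvariant {G : Type u} [Group G] (m : Mean G) : Prop :=
  ∀ (g : G) (A : Set G), m.toFun ((fun h => g * h * g⁻¹) '' A) = m.toFun A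

namespace SimpleGraph

variable {V : Type v} {T : SimpleGraph V}

/-- A ray: a one-sided infinite path without repeated vertices. -/
structure Ray (T : SimpleGraph V) where
  toFun : ℕ → V
  adj : ∀ n, T.Adj (toFun n) (toFun (n + 1))
  injective : Function.Injective toFun

/-- Two rays are cofinal if they have a common tail. -/
def Ray.Cofinal (r s : T.Ray) : Prop :=
  ∃ a b : ℕ, ∀ n, r.toFun (a + n) = s.toFun (b + n)

theorem Ray.cofinal_equivalence : Equivalence (Ray.Cofinal (T := T)) where
  refl _ := ⟨0, 0, fun _ => rfl⟩
  symm := fun ⟨a, b, h⟩ => ⟨b, a, fun n => (h n).symm⟩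
  trans := by
    rintro r s t ⟨a, b, h⟩ ⟨c, d, k⟩
    refine ⟨a + c, d + b, fun n => ?_⟩
    rw [add_assoc, h, add_assoc, ← k]
    congr 1
    omega

instance rayCofinalSetoid (T : SimpleGraph V) : Setoid T.Ray :=
  ⟨Ray.Cofinal, Ray.cofinal_equivalence⟩

/-- The ends of a tree: rays up to having a common tail. -/
def TreeEnd (T : SimpleGraph V) : Type v :=
  Quotient (rayCofinalSetoid T)

/-- The image of a ray under an automorphism. -/
def Ray.map (φ : T ≃g T) (r : T.Ray) : T.Ray where
  toFun n := φ (r.toFun n)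
  adj n := φ.map_adj_iff.2 (r.adj n)
  injective := φ.injective.comp r.injective

/-- The action of an automorphism on the ends. -/
def TreeEnd.map (φ : T ≃g T) : T.TreeEnd → T.TreeEnd :=
  Quotient.map (Ray.map φ) fun _ _ ⟨a, b, h⟩ => ⟨a, b, fun n => congrArg φ (h n)⟩

/-- `S` is a (nonempty) subtree of `T` invariant under the action `ρ` of `G` on `T`. -/
structure IsInvariantSubtree {G : Type u} [Group G] (ρ : G →* (T ≃g T)) (S : T.Subgraph) :
    Prop where
  isTree : S.coe.IsTree
  verts_mem : ∀ (g : G) {x : V}, x ∈ S.verts → ρ g x ∈ S.verts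
  adj : ∀ (g : G) {x y : V}, S.Adj x y → S.Adj (ρ g x) (ρ g y)

end SimpleGraph

/-! The displacement `d(x, gx)` is convex on the tree: once it increases along an edge, it keeps
increasing beyond. Let `A(u,v)` be the set of `g` that move `v` less than `u`. By convexity, nested
half-trees give nested sets `A`, and disjoint half-trees give disjoint sets
(`IsTree.approachSet_subset`, `IsTree.disjoint_approachSet`).

Every invariant subtree contains all essential edges, and these span an invariant subtree, which is
therefore the smallest one. The hypotheses on `G` make essential half-trees embed in one another by
translation (`IsEssential.exists_subset`) and provide a vertex `c` with three essential neighbours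
(`IsTree.exists_three_essential`). So an essential half-tree contains two disjoint translates of
itself; conjugation invariance gives `2 m(A) ≤ m(A)`, hence `m(A) = 0`. Up to a null set, `g` thus
moves both ends of a given essential edge equally far. At `c` this forces `gc = c`, and the
conclusion spreads along essential edges. -/

namespace SimpleGraph

variable {V : Type v} {T : SimpleGraph V}

/-! ### Distances in a tree -/

/-- Geodesics to `v` and to `w`, prolonged to `u`, remain geodesics, so they are the same path and
have the same penultimate vertex. -/
theorem IsTree.eq_of_adj_of_dist_lt (hT : T.IsTree) {x u v w : V} (hv : T.Adj u v)
    (hw : T.Adj u w) (hxv : T.dist x v < T.dist x u) (hxw : T.dist x w < T.dist x u) : v = w := by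
  obtain ⟨p, hp⟩ := hT.connected.exists_walk_length_eq_dist x v
  obtain ⟨q, hq⟩ := hT.connected.exists_walk_length_eq_dist x w
  have hv' := hT.dist_eq_dist_add_one_of_adj x hv
  have hw' := hT.dist_eq_dist_add_one_of_adj x hw
  have h1 : (p.concat hv.symm).IsPath :=
    Walk.isPath_of_length_eq_dist _ (by rw [Walk.length_concat]; omega)
  have h2 : (q.concat hw.symm).IsPath :=
    Walk.isPath_of_length_eq_dist _ (by rw [Walk.length_concat]; omega)
  have h := congrArg (fun r : T.Path x u => (r : T.Walk x u).penultimate)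
    ((hT.isAcyclic.subsingleton_path x u).elim ⟨_, h1⟩ ⟨_, h2⟩)
  simpa using h

theorem Connected.exists_adj_dist_eq (hT : T.Connected) {x u : V} (h : u ≠ x) :
    ∃ v, T.Adj u v ∧ T.dist x u = T.dist x v + 1 := by
  obtain ⟨p, hp⟩ := hT.exists_walk_length_eq_dist u x
  cases p with
  | nil => exact absurd rfl h
  | @cons _ v _ ha q =>
    refine ⟨v, ha, ?_⟩
    have h1 := dist_le q
    have h2 := hT.dist_triangle (u := u) (v := v) (w := x)
    rw [dist_eq_one_iff_adj.2 ha] at h2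
    rw [Walk.length_cons] at hp
    rw [dist_comm (u := x), dist_comm (u := x)]
    omega

theorem Hom.dist_le {W : Type*} {T' : SimpleGraph W} (hT : T.Connected) (φ : T →g T') (x y : V) :
    T'.dist (φ x) (φ y) ≤ T.dist x y := by
  obtain ⟨p, hp⟩ := hT.exists_walk_length_eq_dist x y
  rw [← hp, ← Walk.length_map φ]
  exact SimpleGraph.dist_le _

theorem Iso.dist_eq (hT : T.Connected) (φ : T ≃g T) (x y : V) :
    T.dist (φ x) (φ y) = T.dist x y := by
  refine le_antisymm (Hom.dist_le hT φ.toHom x y) ?_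
  simpa using Hom.dist_le hT φ.symm.toHom (φ x) (φ y)

theorem Connected.induction_adj (hT : T.Connected) {P : V → Prop} (x : V) (hx : P x)
    (step : ∀ y z, T.Adj y z → P y → P z) (y : V) : P y := by
  obtain ⟨p⟩ := hT x y
  induction p with
  | nil => exact hx
  | cons h _ ih => exact ih (step _ _ h hx)

/-! ### Half-trees -/

/-- The half-tree at the side of `v` of the edge from `u` to `v`. -/
def halfTree (T : SimpleGraph V) (u v : V) : Set V :=
  {x | T.dist x v < T.dist x u}

theorem mem_halfTree {u v x : V} : x ∈ T.halfTree u v ↔ T.dist x v < T.dist x u := Iff.rfl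

theorem right_mem_halfTree {u v : V} (h : T.Adj u v) : v ∈ T.halfTree u v := by
  simp [mem_halfTree, dist_eq_one_iff_adj.2 h.symm]

theorem left_notMem_halfTree {u v : V} : u ∉ T.halfTree u v := by
  simp [mem_halfTree]

theorem IsTree.notMem_halfTree (hT : T.IsTree) {u v x : V} (h : T.Adj u v) :
    x ∉ T.halfTree u v ↔ x ∈ T.halfTree v u := by
  have := hT.dist_ne_of_adj x h
  simp only [mem_halfTree]
  omega

theorem IsTree.compl_halfTree (hT : T.IsTree) {u v : V} (h : T.Adj u v) :
    (T.halfTree u v)ᶜ = T.halfTree v u :=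
  Set.ext fun _ => hT.notMem_halfTree h

theorem IsTree.disjoint_halfTree_iff (hT : T.IsTree) {u v : V} (h : T.Adj u v) {A : Set V} :
    Disjoint A (T.halfTree u v) ↔ A ⊆ T.halfTree v u := by
  rw [Set.disjoint_right, ← hT.compl_halfTree h]
  exact ⟨fun k x hx hx' => k hx' hx, fun k x hx hx' => k hx' hx⟩

theorem Iso.mem_halfTree_iff (hT : T.Connected) (φ : T ≃g T) {u v x : V} :
    φ x ∈ T.halfTree (φ u) (φ v) ↔ x ∈ T.halfTree u v := by
  simp only [mem_halfTree, Iso.dist_eq hT]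

theorem Iso.image_halfTree (hT : T.Connected) (φ : T ≃g T) (u v : V) :
    φ '' T.halfTree u v = T.halfTree (φ u) (φ v) := by
  ext x
  obtain ⟨y, rfl⟩ := φ.surjective x
  rw [φ.injective.mem_set_image, Iso.mem_halfTree_iff hT]

/-- The only edge leaving a half-tree is the one that defines it. -/
theorem IsTree.eq_of_mem_halfTree_of_notMem (hT : T.IsTree) {u v x y : V} (huv : T.Adj u v)
    (hxy : T.Adj x y) (hx : x ∈ T.halfTree u v) (hy : y ∉ T.halfTree u v) : x = v ∧ y = u := by
  rw [hT.notMem_halfTree huv] at hy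
  have h1 := hT.dist_eq_dist_add_one_of_adj x huv
  have h2 := hT.dist_eq_dist_add_one_of_adj y huv
  have h3 := hT.dist_eq_dist_add_one_of_adj u hxy
  have h4 := hT.dist_eq_dist_add_one_of_adj v hxy
  simp only [mem_halfTree, dist_comm (u := x), dist_comm (u := y)] at *
  have key : x = v := by
    by_contra hne
    obtain ⟨w, hw, hw'⟩ := hT.connected.exists_adj_dist_eq hne
    have h5 := hT.dist_eq_dist_add_one_of_adj w huv
    simp only [dist_comm (u := w)] at h5
    have := hT.eq_of_adj_of_dist_lt (x := u) hxy hw (by omega) (by omega)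
    subst this
    omega
  refine ⟨key, ?_⟩
  subst key
  rw [← hT.connected.dist_eq_zero_iff, dist_comm]
  simp only [dist_self] at *
  omega

theorem IsTree.dist_eq_of_mem_halfTree (hT : T.IsTree) {u v x y : V} (huv : T.Adj u v)
    (hx : x ∈ T.halfTree u v) (hy : y ∉ T.halfTree u v) :
    T.dist x y = T.dist x v + 1 + T.dist u y := by
  induction hn : T.dist x y generalizing y with
  | zero =>
    rw [hT.connected.dist_eq_zero_iff] at hn
    exact absurd (hn ▸ hx) hy
  | succ n ih =>
    have hne : y ≠ x := fun h => hy (h ▸ hx)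
    obtain ⟨w, hw, hw'⟩ := hT.connected.exists_adj_dist_eq hne
    by_cases h : w ∈ T.halfTree u v
    · obtain ⟨rfl, rfl⟩ := hT.eq_of_mem_halfTree_of_notMem huv hw.symm h hy
      rw [dist_self]
      omega
    · have h1 := ih h (by omega)
      have h2 := hT.connected.dist_triangle (u := x) (v := u) (w := y)
      have h3 := hT.connected.dist_triangle (u := x) (v := v) (w := u)
      have h4 := hT.dist_eq_dist_add_one_of_adj u hw
      rw [dist_eq_one_iff_adj.2 huv.symm] at h3
      omega

/-- For a point `x` violating the inclusion, `p` would lie between `x` and `u`, while `u` would lie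
between `x` and `p`. -/
theorem IsTree.halfTree_subset (hT : T.IsTree) {u v p q : V} (huv : T.Adj u v) (hpq : T.Adj p q)
    (hu : u ∉ T.halfTree p q) (hp : p ∈ T.halfTree u v) :
    T.halfTree p q ⊆ T.halfTree u v := by
  intro x hx
  by_contra h
  have h1 := hT.dist_eq_of_mem_halfTree hpq hx hu
  have h2 := hT.dist_eq_of_mem_halfTree huv hp h
  have h3 := hT.connected.dist_triangle (u := x) (v := q) (w := p)
  rw [dist_eq_one_iff_adj.2 hpq.symm] at h3
  rw [dist_comm (u := p) (v := x), dist_comm (u := u) (v := x)] at h2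
  omega

theorem IsTree.halfTree_subset_or (hT : T.IsTree) {u v p q : V} (huv : T.Adj u v)
    (hpq : T.Adj p q) (hp : p ∈ T.halfTree u v) :
    T.halfTree p q ⊆ T.halfTree u v ∨ T.halfTree q p ⊆ T.halfTree u v := by
  by_cases hu : u ∈ T.halfTree p q
  · right
    by_cases hq : q ∈ T.halfTree u v
    · refine hT.halfTree_subset huv hpq.symm ?_ hq
      rwa [hT.notMem_halfTree hpq.symm]
    · obtain ⟨rfl, rfl⟩ := hT.eq_of_mem_halfTree_of_notMem huv hpq hp hq
      exact subset_rfl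
  · exact Or.inl (hT.halfTree_subset huv hpq hu hp)

theorem IsTree.disjoint_halfTree_of_ne (hT : T.IsTree) {c a b : V} (ha : T.Adj c a)
    (hb : T.Adj c b) (hab : a ≠ b) : Disjoint (T.halfTree c a) (T.halfTree c b) :=
  Set.disjoint_left.2 fun _ hxa hxb => hab (hT.eq_of_adj_of_dist_lt ha hb hxa hxb)

/-! ### Paths without backtracking -/

theorem IsTree.dist_of_no_backtrack (hT : T.IsTree) {r : ℕ → V}
    (hadj : ∀ n, T.Adj (r n) (r (n + 1))) (hne : ∀ n, r (n + 2) ≠ r n) (n : ℕ) :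
    T.dist (r 0) (r n) = n := by
  have key : ∀ n, T.dist (r 0) (r n) = n ∧ T.dist (r 0) (r (n + 1)) = n + 1 := by
    intro n
    induction n with
    | zero => simpa using dist_eq_one_iff_adj.2 (hadj 0)
    | succ n ih =>
      refine ⟨ih.2, ?_⟩
      rcases hT.dist_eq_dist_add_one_of_adj (r 0) (hadj (n + 1)) with h | h
      · exact absurd (hT.eq_of_adj_of_dist_lt (x := r 0) (hadj (n + 1)) (hadj n).symm
          (by omega) (by omega)) (hne n)
      · omega
  exact (key n).1

/-- A path without backtracking in a tree is a ray. -/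
def Ray.ofNoBacktrack (hT : T.IsTree) (r : ℕ → V) (hadj : ∀ n, T.Adj (r n) (r (n + 1)))
    (hne : ∀ n, r (n + 2) ≠ r n) : T.Ray where
  toFun := r
  adj := hadj
  injective := by
    refine Function.Injective.of_lt_imp_ne fun m n hmn h => ?_
    have := hT.dist_of_no_backtrack (r := fun k => r (m + k)) (fun k => hadj (m + k))
      (fun k => hne (m + k)) (n - m)
    simp only [add_zero, Nat.add_sub_cancel' hmn.le, h, dist_self] at this
    omega

theorem Ray.mem_halfTree (hT : T.IsTree) (r : T.Ray) (n : ℕ) :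
    r.toFun (n + 1) ∈ T.halfTree (r.toFun 0) (r.toFun 1) := by
  have h1 := hT.dist_of_no_backtrack r.adj (fun n h => by simpa using r.injective h) (n + 1)
  have h2 := hT.dist_of_no_backtrack (r := fun k => r.toFun (k + 1)) (fun k => r.adj (k + 1))
    (fun n h => by simpa using r.injective h) n
  rw [SimpleGraph.mem_halfTree, dist_comm, dist_comm (v := r.toFun 0)]
  simp only [zero_add] at h2
  omega

end SimpleGraph

namespace SimpleGraph

variable {V : Type v} {T : SimpleGraph V}

/-! ### Displacement functions of automorphisms -/

/-- The drop at `w` means that the geodesic from `x` to `φ x` passes through `w` and `φ w`. Hence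
`y` and `φ y` prolong it at both ends, and the displacement grows by 2. -/
theorem IsTree.displacement_lt_of_lt (hT : T.IsTree) (φ : T ≃g T) {w x y : V} (hw : T.Adj x w)
    (hy : T.Adj x y) (hwy : w ≠ y) (h : T.dist w (φ w) < T.dist x (φ x)) :
    T.dist x (φ x) < T.dist y (φ y) := by
  have hφw : T.Adj (φ x) (φ w) := φ.map_adj_iff.2 hw
  have hφy : T.Adj (φ x) (φ y) := φ.map_adj_iff.2 hy
  have d1 := hT.dist_eq_dist_add_one_of_adj (φ x) hw
  have d2 := hT.dist_eq_dist_add_one_of_adj w hφw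
  have d3 := hT.dist_eq_dist_add_one_of_adj (φ w) hw
  have d4 := hT.dist_eq_dist_add_one_of_adj (φ x) hy
  have d5 := hT.dist_eq_dist_add_one_of_adj y hφw
  have d6 := hT.dist_eq_dist_add_one_of_adj y hφy
  have d7 := hT.dist_eq_dist_add_one_of_adj (φ w) hy
  simp only [dist_comm (u := φ x), dist_comm (u := φ w)] at d1 d3 d4 d7
  have e1 : T.dist x (φ x) = T.dist w (φ x) + 1 := by omega
  have e2 : T.dist y (φ x) = T.dist x (φ x) + 1 := by
    rcases d4 with d4 | d4
    · exact absurd (hT.eq_of_adj_of_dist_lt (x := φ x) hw hy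
        (by rw [dist_comm, dist_comm (u := φ x)]; omega)
        (by rw [dist_comm, dist_comm (u := φ x)]; omega)) hwy
    · exact d4
  have e3 : T.dist y (φ y) = T.dist y (φ x) + 1 := by
    rcases d6 with d6 | d6
    · exact absurd (hT.eq_of_adj_of_dist_lt (x := y) hφw hφy (by omega) (by omega))
        (fun h => hwy (φ.injective h))
    · exact d6
  omega

/-- The geodesic from `v` to `y` starts with the edge to `u` and ends with the edge from `x`; local
growth propagates along it. -/
theorem IsTree.displacement_lt_of_halfTree (hT : T.IsTree) (φ : T ≃g T) {u v x y : V}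
    (huv : T.Adj u v) (hxy : T.Adj x y) (h : T.dist v (φ v) < T.dist u (φ u))
    (hv : v ∉ T.halfTree x y) (hy : y ∉ T.halfTree u v) :
    T.dist x (φ x) < T.dist y (φ y) := by
  induction hn : T.dist v x generalizing x y with
  | zero =>
    rw [hT.connected.dist_eq_zero_iff] at hn
    subst hn
    have := (hT.eq_of_mem_halfTree_of_notMem huv hxy (right_mem_halfTree huv) hy).2
    rwa [this]
  | succ n ih =>
    have hne : x ≠ v := by
      rintro rfl
      simp at hn
    have hx : x ∉ T.halfTree u v := fun hx =>
      hne (hT.eq_of_mem_halfTree_of_notMem huv hxy hx hy).1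
    obtain ⟨w, hw, hw'⟩ := hT.connected.exists_adj_dist_eq hne
    have hlt := ih hw.symm (by rw [mem_halfTree]; omega) hx (by omega)
    refine hT.displacement_lt_of_lt φ hw hxy ?_ hlt
    rintro rfl
    rw [mem_halfTree] at hv
    omega

/-- A vertex with three neighbours of the same displacement is fixed. -/
theorem IsTree.apply_eq_of_three_neighbors (hT : T.IsTree) (φ : T ≃g T) {c : V} {a : Fin 3 → V}
    (ha : Function.Injective a) (hadj : ∀ i, T.Adj c (a i))
    (h : ∀ i, T.dist (a i) (φ (a i)) = T.dist c (φ c)) : φ c = c := by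
  by_contra hne
  obtain ⟨w, hw, hw'⟩ := hT.connected.exists_adj_dist_eq (x := φ c) (u := c) (Ne.symm hne)
  obtain ⟨z, hz, hz'⟩ := hT.connected.exists_adj_dist_eq (x := c) hne
  -- Any other neighbour has displacement larger by 2. Each alternative holds for at most one index,
  -- so three neighbours are too many.
  have key : ∀ i, a i = w ∨ φ (a i) = z := by
    intro i
    by_contra! hcon
    have hφ : T.Adj (φ c) (φ (a i)) := φ.map_adj_iff.2 (hadj i)
    have d1 := hT.dist_eq_dist_add_one_of_adj (φ c) (hadj i)
    have d2 := hT.dist_eq_dist_add_one_of_adj (a i) hφ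
    have d3 := hT.dist_eq_dist_add_one_of_adj z (hadj i)
    have e1 : ¬ T.dist (φ c) (a i) < T.dist (φ c) c := fun hlt =>
      hcon.1 (hT.eq_of_adj_of_dist_lt (hadj i) hw hlt (by omega))
    have hi := h i
    simp only [dist_comm (u := φ c), dist_comm (u := z)] at d1 d3 e1
    exact hcon.2 (hT.eq_of_adj_of_dist_lt (x := a i) hφ hz (by omega) (by omega))
  have hzz : ∀ i j, φ (a i) = z → φ (a j) = z → i = j := fun i j hi hj =>
    ha (φ.injective (hi.trans hj.symm))
  have hww : ∀ i j, a i = w → a j = w → i = j := fun i j hi hj => ha (hi.trans hj.symm)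
  have h0 := key 0
  have h1 := key 1
  have h2 := key 2
  have n01 := hzz 0 1
  have n02 := hzz 0 2
  have n12 := hzz 1 2
  have m01 := hww 0 1
  have m02 := hww 0 2
  have m12 := hww 1 2
  simp only [Fin.reduceEq] at n01 n02 n12 m01 m02 m12
  tauto

end SimpleGraph

/-! ### Means -/

namespace Mean

variable {X : Type u} (m : Mean X)

theorem mono {A B : Set X} (h : A ⊆ B) : m.toFun A ≤ m.toFun B := by
  have := m.union A (B \ A) Set.disjoint_sdiff_right
  rw [Set.union_sdiff_cancel h] at this
  have := m.nonneg (B \ A)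
  linarith

theorem union_eq_zero {A B : Set X} (hA : m.toFun A = 0) (hB : m.toFun B = 0) :
    m.toFun (A ∪ B) = 0 := by
  have h1 := m.union A (B \ A) Set.disjoint_sdiff_right
  rw [Set.union_sdiff_self] at h1
  have h2 := m.mono (Set.sdiff_subset : B \ A ⊆ B)
  have h3 := m.nonneg (A ∪ B)
  linarith

theorem eq_zero_of_subset {A B : Set X} (h : A ⊆ B) (hB : m.toFun B = 0) : m.toFun A = 0 :=
  le_antisymm (hB ▸ m.mono h) (m.nonneg A)

theorem eq_one_of_compl {A : Set X} (h : m.toFun Aᶜ = 0) : m.toFun A = 1 := by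
  have := m.union A Aᶜ disjoint_compl_right
  rw [Set.union_compl_self, m.univ] at this
  linarith

end Mean

namespace SimpleGraph

variable {V : Type v} {T : SimpleGraph V} {G : Type u} [Group G] (ρ : G →* (T ≃g T))

/-! ### Groups acting on trees -/

theorem map_mul_apply (g h : G) (x : V) : ρ (g * h) x = ρ g (ρ h x) := by
  rw [map_mul]; rfl

theorem map_inv_apply_self (g : G) (x : V) : ρ g⁻¹ (ρ g x) = x := by
  rw [← map_mul_apply, inv_mul_cancel, map_one]; rfl

theorem map_apply_inv_self (g : G) (x : V) : ρ g (ρ g⁻¹ x) = x := by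
  rw [← map_mul_apply, mul_inv_cancel, map_one]; rfl

/-- If a half-tree contains an orbit, then it contains the orbit of its root. -/
theorem IsTree.orbit_root_mem_halfTree (hT : T.IsTree) {u v x : V} (huv : T.Adj u v)
    (h : ∀ g, ρ g x ∈ T.halfTree u v) (g : G) : ρ g v ∈ T.halfTree u v := by
  -- Take the orbit point `kx` nearest to `v`. If `gv` were across the edge, `gkx` would be strictly
  -- closer to `v` than to `gv`, contradicting minimality.
  obtain ⟨k, hk⟩ : ∃ k, ∀ g, T.dist (ρ k x) v ≤ T.dist (ρ g x) v :=
    ⟨_, fun g => Function.argmin_le (fun k => T.dist (ρ k x) v) g⟩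
  by_contra hg
  have h1 := hT.dist_eq_of_mem_halfTree huv (h (g * k)) hg
  have h2 := hk (g * k)
  rw [map_mul_apply, Iso.dist_eq hT.connected, ← map_mul_apply] at h1
  omega

/-- A group that preserves an orientation of the edges of a tree, such that no two oriented edges
point away from each other, fixes a vertex or an end. -/
theorem IsTree.exists_fixed_of_orientation (hT : T.IsTree) (D : V → V → Prop)
    (hadj : ∀ u v, D u v → T.Adj u v) (htotal : ∀ u v, T.Adj u v → D u v ∨ D v u)
    (hinv : ∀ (g : G) u v, D u v → D (ρ g u) (ρ g v))
    (hdisj : ∀ u v p q, D u v → D p q → ¬ Disjoint (T.halfTree u v) (T.halfTree p q)) :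
    (∃ x : V, ∀ g : G, ρ g x = x) ∨ ∃ a : T.TreeEnd, ∀ g : G, TreeEnd.map (ρ g) a = a := by
  have hasymm : ∀ u v, D u v → ¬ D v u := fun u v h h' =>
    hdisj _ _ _ _ h h' ((hT.disjoint_halfTree_iff (hadj _ _ h')).2 subset_rfl)
  have huniq : ∀ x a b, D x a → D x b → a = b := fun x a b ha hb => by
    by_contra hab
    exact hdisj _ _ _ _ ha hb (hT.disjoint_halfTree_of_ne (hadj _ _ ha) (hadj _ _ hb) hab)
  by_cases hsink : ∃ x, ∀ y, ¬ D x y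
  · obtain ⟨x, hx⟩ := hsink
    -- All edges point towards the sink `x`; a translate of `x` is again a sink, so it is `x`.
    have key : ∀ n z w, T.Adj z w → T.dist x w = n → T.dist x z = n + 1 → D z w := by
      intro n
      induction n with
      | zero =>
        intro z w hzw hw _
        rw [hT.connected.dist_eq_zero_iff] at hw
        subst hw
        exact (htotal _ _ hzw).resolve_right (hx z)
      | succ n ih =>
        intro z w hzw hw hz
        have hne : w ≠ x := by
          rintro rfl
          simp at hw
        obtain ⟨w', hw', hd⟩ := hT.connected.exists_adj_dist_eq hne
        have hD := ih w w' hw' (by omega) hw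
        refine (htotal _ _ hzw).resolve_right fun hD' => ?_
        have := huniq _ _ _ hD hD'
        subst this
        omega
    refine Or.inl ⟨x, fun g => ?_⟩
    by_contra hne
    obtain ⟨w, hw, hd⟩ := hT.connected.exists_adj_dist_eq hne
    have := hinv g⁻¹ _ _ (key _ _ _ hw rfl hd)
    rw [map_inv_apply_self] at this
    exact hx _ this
  · push Not at hsink
    -- Without a sink, each vertex has exactly one outgoing edge. Following these edges gives rays
    -- that all merge, so their common end is fixed.
    choose next hnext using hsink
    have hequiv : ∀ g x, ρ g (next x) = next (ρ g x) := fun g x =>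
      huniq _ _ _ (hinv g _ _ (hnext x)) (hnext _)
    have hiter : ∀ g n x, ρ g (next^[n] x) = next^[n] (ρ g x) := by
      intro g n
      induction n with
      | zero => exact fun _ => rfl
      | succ n ih => exact fun x => by rw [Function.iterate_succ_apply, ih, hequiv,
          Function.iterate_succ_apply]
    have hmerge : ∀ x y, ∃ a b, next^[a] x = next^[b] y := by
      intro x y
      refine hT.connected.induction_adj (P := fun y => ∃ a b, next^[a] x = next^[b] y) x
        ⟨0, 0, rfl⟩ ?_ y
      rintro y z hyz ⟨a, b, hab⟩
      rcases htotal _ _ hyz with h | h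
      · refine ⟨a + 1, b, ?_⟩
        rw [Function.iterate_succ_apply', hab, ← Function.iterate_succ_apply' next,
          Function.iterate_succ_apply, huniq _ _ _ (hnext y) h]
      · refine ⟨a, b + 1, ?_⟩
        rw [hab, Function.iterate_succ_apply, huniq _ _ _ (hnext z) h]
    have hstep : ∀ x n, next^[n + 1] x = next (next^[n] x) := fun x n =>
      Function.iterate_succ_apply' next n x
    obtain ⟨x⟩ := hT.connected.nonempty
    let r : T.Ray := Ray.ofNoBacktrack hT (fun n => next^[n] x)
      (fun n => by
        rw [hstep]
        exact hadj _ _ (hnext _))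
      (fun n h => by
        rw [hstep, hstep] at h
        have := hnext (next (next^[n] x))
        rw [h] at this
        exact hasymm _ _ (hnext _) this)
    refine Or.inr ⟨Quotient.mk _ r, fun g => Quotient.sound ?_⟩
    obtain ⟨a, b, hab⟩ := hmerge (ρ g x) x
    refine ⟨a, b, fun n => ?_⟩
    change ρ g (next^[a + n] x) = next^[b + n] x
    rw [hiter, add_comm a, add_comm b, Function.iterate_add_apply, hab,
      ← Function.iterate_add_apply]

/-! ### Essential edges -/

/-- An edge is essential if each orbit meets both of its half-trees. -/
structure IsEssential (u v : V) : Prop where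
  adj : T.Adj u v
  right : ∀ x, ∃ g, ρ g x ∈ T.halfTree u v
  left : ∀ x, ∃ g, ρ g x ∈ T.halfTree v u

variable {ρ}

theorem IsEssential.symm {u v : V} (h : IsEssential ρ u v) : IsEssential ρ v u :=
  ⟨h.adj.symm, h.left, h.right⟩

theorem IsEssential.map (hT : T.IsTree) {u v : V} (h : IsEssential ρ u v) (k : G) :
    IsEssential ρ (ρ k u) (ρ k v) := by
  refine ⟨(ρ k).map_adj_iff.2 h.adj, fun x => ?_, fun x => ?_⟩
  · obtain ⟨g, hg⟩ := h.right x
    refine ⟨k * g, ?_⟩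
    rwa [map_mul_apply, Iso.mem_halfTree_iff hT.connected]
  · obtain ⟨g, hg⟩ := h.left x
    refine ⟨k * g, ?_⟩
    rwa [map_mul_apply, Iso.mem_halfTree_iff hT.connected]

theorem IsEssential.of_halfTree_subset {u v p q a b : V} (hab : T.Adj a b)
    (h : IsEssential ρ u v) (h' : IsEssential ρ p q) (hs : T.halfTree u v ⊆ T.halfTree a b)
    (hp : T.halfTree p q ⊆ T.halfTree b a) : IsEssential ρ a b :=
  ⟨hab, fun x => (h.right x).imp fun _ hg => hs hg, fun x => (h'.right x).imp fun _ hg => hp hg⟩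

/-- The essential edges span a convex set. -/
theorem IsEssential.of_mem_halfTree (hT : T.IsTree) {x x' y y' w : V} (hx : IsEssential ρ x x')
    (hy : IsEssential ρ y y') (hw : T.Adj x w) (hyw : y ∈ T.halfTree x w) :
    IsEssential ρ x w := by
  by_cases hne : w = x'
  · rwa [hne]
  -- It suffices that each side of the edge from `x` to `w` contains a half-tree of an essential
  -- edge.
  have h1 : T.halfTree x x' ⊆ T.halfTree w x := by
    refine hT.halfTree_subset hw.symm hx.adj (fun hmem => hne ?_) (right_mem_halfTree hw.symm)
    exact (hT.eq_of_mem_halfTree_of_notMem hx.adj hw.symm hmem left_notMem_halfTree).1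
  rcases hT.halfTree_subset_or hw hy.adj hyw with h | h
  · exact .of_halfTree_subset hw hy hx h h1
  · exact .of_halfTree_subset hw hy.symm hx h h1

/-! ### Translating half-trees into one another. -/

theorem Iso.halfTree_subset_iff (hT : T.Connected) (φ : T ≃g T) {u v p q : V} :
    T.halfTree (φ u) (φ v) ⊆ T.halfTree (φ p) (φ q) ↔ T.halfTree u v ⊆ T.halfTree p q := by
  rw [← Iso.image_halfTree hT, ← Iso.image_halfTree hT, Set.image_subset_image_iff φ.injective]

theorem Iso.disjoint_halfTree_iff (hT : T.Connected) (φ : T ≃g T) {u v p q : V} :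
    Disjoint (T.halfTree (φ u) (φ v)) (T.halfTree (φ p) (φ q)) ↔
      Disjoint (T.halfTree u v) (T.halfTree p q) := by
  rw [← Iso.image_halfTree hT, ← Iso.image_halfTree hT, Set.disjoint_image_iff φ.injective]

/-- If no edge is essential, every edge has a whole orbit on one side, hence the orbit of its
endpoint there. Pointing edges to such sides gives a consistent invariant orientation. -/
theorem IsTree.exists_isEssential (hT : T.IsTree)
    (no_fixed_vertex : ¬ ∃ x : V, ∀ g : G, ρ g x = x)
    (no_fixed_end : ¬ ∃ a : T.TreeEnd, ∀ g : G, TreeEnd.map (ρ g) a = a) :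
    ∃ u v, IsEssential ρ u v := by
  by_contra! hess
  refine (hT.exists_fixed_of_orientation ρ
    (fun u v => T.Adj u v ∧ ∀ g, ρ g v ∈ T.halfTree u v) (fun _ _ h => h.1)
    ?_ ?_ ?_).elim no_fixed_vertex no_fixed_end
  · intro u v huv
    by_contra! hcon
    obtain ⟨g, hg⟩ := hcon.1 huv
    obtain ⟨k, hk⟩ := hcon.2 huv.symm
    refine hess u v ⟨huv, fun x => ?_, fun x => ?_⟩
    · by_contra! hx
      exact hk (hT.orbit_root_mem_halfTree ρ huv.symm
        (fun g => (hT.notMem_halfTree huv).1 (hx g)) k)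
    · by_contra! hx
      exact hg (hT.orbit_root_mem_halfTree ρ huv
        (fun g => (hT.notMem_halfTree huv.symm).1 (hx g)) g)
  · rintro k u v ⟨huv, h⟩
    refine ⟨(ρ k).map_adj_iff.2 huv, fun g => ?_⟩
    rw [← Iso.mem_halfTree_iff hT.connected (ρ k⁻¹), map_inv_apply_self, map_inv_apply_self,
      ← map_mul_apply, ← map_mul_apply]
    exact h _
  · rintro u v p q ⟨huv, h⟩ ⟨hpq, h'⟩ hd
    -- Now the orbits of `u` and `v` stay on opposite sides, so each translate of the edge crosses
    -- it and `v` is fixed.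
    have hu : ∀ g, ρ g u ∈ T.halfTree v u := hT.orbit_root_mem_halfTree ρ huv.symm fun g =>
      (hT.disjoint_halfTree_iff huv).1 hd.symm (h' g)
    refine no_fixed_vertex ⟨v, fun g => ?_⟩
    exact (hT.eq_of_mem_halfTree_of_notMem huv ((ρ g).map_adj_iff.2 huv.symm) (h g)
      ((hT.notMem_halfTree huv).2 (hu g))).1

/-- Some translate of the edge has `p` on the side of the translate of `u`. That side contains a
half-tree of the edge `p q`; taking complements gives the claim. -/
theorem IsEssential.exists_subset_or (hT : T.IsTree) {u v p q : V} (h : IsEssential ρ u v)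
    (hpq : T.Adj p q) : (∃ g, T.halfTree (ρ g u) (ρ g v) ⊆ T.halfTree p q) ∨
      ∃ g, T.halfTree (ρ g u) (ρ g v) ⊆ T.halfTree q p := by
  obtain ⟨g, hg⟩ := h.left p
  have hadj : T.Adj (ρ g⁻¹ u) (ρ g⁻¹ v) := (ρ g⁻¹).map_adj_iff.2 h.adj
  have hp : p ∈ T.halfTree (ρ g⁻¹ v) (ρ g⁻¹ u) := by
    rwa [← Iso.mem_halfTree_iff hT.connected (ρ g), map_apply_inv_self, map_apply_inv_self]
  rcases hT.halfTree_subset_or hadj.symm hpq hp with hs | hs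
  · refine Or.inr ⟨g⁻¹, ?_⟩
    rw [← hT.compl_halfTree hadj.symm, ← hT.compl_halfTree hpq]
    exact Set.compl_subset_compl.2 hs
  · refine Or.inl ⟨g⁻¹, ?_⟩
    rw [← hT.compl_halfTree hadj.symm, ← hT.compl_halfTree hpq.symm]
    exact Set.compl_subset_compl.2 hs

/-- If all translates of the half-tree met one another, pointing each edge to a side containing a
translate would give a consistent orientation. -/
theorem IsEssential.exists_disjoint (hT : T.IsTree)
    (no_fixed_vertex : ¬ ∃ x : V, ∀ g : G, ρ g x = x)
    (no_fixed_end : ¬ ∃ a : T.TreeEnd, ∀ g : G, TreeEnd.map (ρ g) a = a)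
    {u v : V} (h : IsEssential ρ u v) :
    ∃ g, Disjoint (T.halfTree u v) (T.halfTree (ρ g u) (ρ g v)) := by
  by_contra! hcon
  refine (hT.exists_fixed_of_orientation ρ
    (fun p q => T.Adj p q ∧ ∃ g, T.halfTree (ρ g u) (ρ g v) ⊆ T.halfTree p q)
    (fun _ _ h => h.1) ?_ ?_ ?_).elim no_fixed_vertex no_fixed_end
  · intro p q hpq
    exact (h.exists_subset_or hT hpq).imp (fun h => ⟨hpq, h⟩) (fun h => ⟨hpq.symm, h⟩)
  · rintro k p q ⟨hpq, g, hg⟩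
    refine ⟨(ρ k).map_adj_iff.2 hpq, k * g, ?_⟩
    rwa [map_mul_apply, map_mul_apply, Iso.halfTree_subset_iff hT.connected]
  · rintro a b p q ⟨-, g, hg⟩ ⟨-, k, hk⟩ hd
    refine hcon (g⁻¹ * k) ?_
    rw [← Iso.disjoint_halfTree_iff hT.connected (ρ g), map_mul_apply, map_mul_apply,
      map_apply_inv_self, map_apply_inv_self]
    exact hd.mono hg hk

/-- The half-tree of an essential edge contains a translate of any half-tree that is bounded by an
essential edge. -/
theorem IsEssential.exists_subset (hT : T.IsTree)
    (no_fixed_vertex : ¬ ∃ x : V, ∀ g : G, ρ g x = x)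
    (no_fixed_end : ¬ ∃ a : T.TreeEnd, ∀ g : G, TreeEnd.map (ρ g) a = a)
    {u v p q : V} (h : IsEssential ρ u v) (h' : IsEssential ρ p q) :
    ∃ g, T.halfTree (ρ g u) (ρ g v) ⊆ T.halfTree p q := by
  rcases h.exists_subset_or hT h'.adj with hs | ⟨g, hg⟩
  · exact hs
  · obtain ⟨k, hk⟩ := h'.symm.exists_disjoint hT no_fixed_vertex no_fixed_end
    refine ⟨k * g, ?_⟩
    rw [map_mul_apply, map_mul_apply]
    exact ((Iso.halfTree_subset_iff hT.connected _).2 hg).trans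
      ((hT.disjoint_halfTree_iff h'.symm.adj).1 hk.symm)

end SimpleGraph

/-! ### Branching of the essential edges. -/

namespace SimpleGraph

variable {V : Type v} {T : SimpleGraph V} {G : Type u} [Group G] {ρ : G →* (T ≃g T)}

theorem IsEssential.induction (hT : T.IsTree) {P : V → Prop} {x x' y y' : V}
    (hx : IsEssential ρ x x') (hy : IsEssential ρ y y') (hPx : P x)
    (step : ∀ a b, IsEssential ρ a b → P a → P b) : P y := by
  induction hn : T.dist x y generalizing y y' with
  | zero =>
    rw [hT.connected.dist_eq_zero_iff] at hn
    rwa [← hn]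
  | succ n ih =>
    have hne : y ≠ x := by
      rintro rfl
      simp at hn
    obtain ⟨w, hw, hd⟩ := hT.connected.exists_adj_dist_eq hne
    have hyw : IsEssential ρ y w :=
      hy.of_mem_halfTree hT hx hw (by rw [mem_halfTree]; omega)
    exact step _ _ hyw.symm (ih hyw.symm (by omega))

/-- Some translate of the edge differs from it. If it lies behind `u`, another translation carries
it beyond `v`; the path from `v` towards it then starts with an essential edge. -/
theorem IsEssential.exists_next (hT : T.IsTree)
    (no_fixed_vertex : ¬ ∃ x : V, ∀ g : G, ρ g x = x)
    (no_fixed_edge : ¬ ∃ e ∈ T.edgeSet, ∀ g : G, Sym2.map (ρ g) e = e)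
    (no_fixed_end : ¬ ∃ a : T.TreeEnd, ∀ g : G, TreeEnd.map (ρ g) a = a)
    {u v : V} (h : IsEssential ρ u v) : ∃ w, w ≠ u ∧ IsEssential ρ v w := by
  have key : ∀ p q, IsEssential ρ p q → p ∈ T.halfTree u v → p ≠ v →
      ∃ w, w ≠ u ∧ IsEssential ρ v w := by
    intro p q hpq hp hne
    obtain ⟨w, hw, hd⟩ := hT.connected.exists_adj_dist_eq (Ne.symm hne)
    refine ⟨w, ?_, h.symm.of_mem_halfTree hT hpq hw (by rw [mem_halfTree]; omega)⟩
    rintro rfl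
    rw [mem_halfTree] at hp
    omega
  have key' : ∀ p q, IsEssential ρ p q → p ∈ T.halfTree u v → q ∈ T.halfTree u v →
      ∃ w, w ≠ u ∧ IsEssential ρ v w := by
    intro p q hpq hp hq
    by_cases hne : p = v
    · exact key q p hpq.symm hq fun hqv => hpq.adj.ne (hne.trans hqv.symm)
    · exact key p q hpq hp hne
  obtain ⟨g, hg⟩ := h.symm.exists_subset hT no_fixed_vertex no_fixed_end h
  have hgu : ρ g u ∈ T.halfTree u v :=
    hg (right_mem_halfTree ((ρ g).map_adj_iff.2 h.adj.symm))
  obtain ⟨k, hk⟩ : ∃ k, Sym2.map (ρ k) s(u, v) ≠ s(u, v) := by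
    by_contra! hcon
    exact no_fixed_edge ⟨s(u, v), h.adj, hcon⟩
  have hkuv : T.Adj (ρ k u) (ρ k v) := (ρ k).map_adj_iff.2 h.adj
  by_cases hku : ρ k u ∈ T.halfTree u v
  · by_cases hkv : ρ k v ∈ T.halfTree u v
    · exact key' _ _ (h.map hT k) hku hkv
    · obtain ⟨h1, h2⟩ := hT.eq_of_mem_halfTree_of_notMem h.adj hkuv hku hkv
      rw [Sym2.map_mk, h1, h2, Sym2.eq_swap] at hk
      exact absurd rfl hk
  · by_cases hkv : ρ k v ∈ T.halfTree u v
    · obtain ⟨h1, h2⟩ := hT.eq_of_mem_halfTree_of_notMem h.adj hkuv.symm hkv hku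
      rw [Sym2.map_mk, h1, h2] at hk
      exact absurd rfl hk
    · rw [hT.notMem_halfTree h.adj] at hku hkv
      refine key' _ _ ((h.map hT k).map hT g) (hg ?_) (hg ?_) <;>
      rwa [Iso.mem_halfTree_iff hT.connected]

theorem IsEssential.exists_ray (hT : T.IsTree)
    (hnext : ∀ u v, IsEssential ρ u v → ∃ w, w ≠ u ∧ IsEssential ρ v w)
    {u v : V} (h : IsEssential ρ u v) : ∃ r : T.Ray, r.toFun 0 = u ∧ r.toFun 1 = v ∧
      ∀ n, IsEssential ρ (r.toFun n) (r.toFun (n + 1)) := by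
  let D := {d : V × V // IsEssential ρ d.1 d.2}
  choose! f hne hess using hnext
  let next : D → D := fun d => ⟨(d.1.2, f d.1.1 d.1.2), hess _ _ d.2⟩
  let s : ℕ → D := fun n => next^[n] ⟨(u, v), h⟩
  have hs : ∀ n, s (n + 1) = next (s n) := fun n => Function.iterate_succ_apply' _ _ _
  have h1 : ∀ n, (s (n + 1)).1.1 = (s n).1.2 := fun n => by rw [hs]
  have h2 : ∀ n, IsEssential ρ (s n).1.1 (s (n + 1)).1.1 := fun n => by
    rw [h1]; exact (s n).2
  refine ⟨Ray.ofNoBacktrack hT (fun n => (s n).1.1) (fun n => (h2 n).adj) fun n => ?_,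
    rfl, rfl, h2⟩
  rw [h1, hs]
  exact hne _ _ (s n).2

theorem Ray.ne_add_two (r : T.Ray) (n : ℕ) : r.toFun (n + 2) ≠ r.toFun n :=
  fun h => by simpa using r.injective h

/-- The ray obtained from a ray by deleting its first vertex. -/
def Ray.tail (r : T.Ray) : T.Ray where
  toFun n := r.toFun (n + 1)
  adj n := r.adj (n + 1)
  injective := r.injective.comp (add_left_injective 1)

theorem Ray.tail_cofinal (r : T.Ray) : r.tail.Cofinal r :=
  ⟨0, 1, fun n => by simp only [Ray.tail]; congr 1; omega⟩

/-- The ray obtained from a ray by adding a vertex at its beginning. -/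
def Ray.cons (hT : T.IsTree) (r : T.Ray) (x : V) (hx : T.Adj x (r.toFun 0))
    (hne : r.toFun 1 ≠ x) : T.Ray :=
  Ray.ofNoBacktrack hT (fun n => n.casesOn x r.toFun)
    (fun n => by cases n with | zero => exact hx | succ n => exact r.adj n)
    (fun n => by cases n with | zero => exact hne | succ n => exact r.ne_add_two n)

theorem Ray.cofinal_cons (hT : T.IsTree) (r : T.Ray) (x : V) (hx : T.Adj x (r.toFun 0))
    (hne : r.toFun 1 ≠ x) : r.Cofinal (r.cons hT x hx hne) :=
  ⟨0, 1, fun n => by rw [zero_add, add_comm]; rfl⟩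

/-- Some vertex has three neighbours along essential edges. -/
theorem IsTree.exists_three_essential (hT : T.IsTree)
    (no_fixed_vertex : ¬ ∃ x : V, ∀ g : G, ρ g x = x)
    (no_fixed_edge : ¬ ∃ e ∈ T.edgeSet, ∀ g : G, Sym2.map (ρ g) e = e)
    (no_fixed_end : ¬ ∃ a : T.TreeEnd, ∀ g : G, TreeEnd.map (ρ g) a = a)
    (no_fixed_pair_of_ends : ¬ ∃ a b : T.TreeEnd, a ≠ b ∧
      ∀ g : G, TreeEnd.map (ρ g) '' {a, b} = {a, b}) :
    ∃ (c : V) (a : Fin 3 → V), Function.Injective a ∧ ∀ i, IsEssential ρ c (a i) := by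
  by_contra! hcon
  have htwo : ∀ c a b d, IsEssential ρ c a → IsEssential ρ c b → IsEssential ρ c d →
      a ≠ b → a ≠ d → b = d := by
    intro c a b d ha hb hd hab had
    by_contra hbd
    obtain ⟨i, hi⟩ := hcon c ![a, b, d] (by
      intro i j hij
      fin_cases i <;> fin_cases j <;> simp_all)
    fin_cases i <;> simp_all
  have hnext : ∀ u v, IsEssential ρ u v → ∃ w, w ≠ u ∧ IsEssential ρ v w := fun u v h =>
    h.exists_next hT no_fixed_vertex no_fixed_edge no_fixed_end
  -- Without branching, the essential edges form a line: a ray in it is determined by its first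
  -- edge, and only two ends occur.
  have huniq : ∀ r s : T.Ray, (∀ n, IsEssential ρ (r.toFun n) (r.toFun (n + 1))) →
      (∀ n, IsEssential ρ (s.toFun n) (s.toFun (n + 1))) → r.toFun 0 = s.toFun 0 →
      r.toFun 1 = s.toFun 1 → r.Cofinal s := by
    intro r s hr hs h0 h1
    have : ∀ n, r.toFun n = s.toFun n ∧ r.toFun (n + 1) = s.toFun (n + 1) := by
      intro n
      induction n with
      | zero => exact ⟨h0, h1⟩
      | succ n ih =>
        refine ⟨ih.2, htwo (r.toFun (n + 1)) (r.toFun n) _ _ (hr n).symm (hr (n + 1)) ?_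
          (r.ne_add_two n).symm ?_⟩
        · rw [ih.2]; exact hs (n + 1)
        · rw [ih.1]; exact (s.ne_add_two n).symm
    exact ⟨0, 0, fun n => by rw [(this _).1]⟩
  obtain ⟨u, v, huv⟩ := hT.exists_isEssential no_fixed_vertex no_fixed_end
  obtain ⟨r, hr0, hr1, hr⟩ := huv.exists_ray hT hnext
  obtain ⟨s, hs0, hs1, hs⟩ := huv.symm.exists_ray hT hnext
  have hall : ∀ y y', IsEssential ρ y y' → ∀ t : T.Ray,
      (∀ n, IsEssential ρ (t.toFun n) (t.toFun (n + 1))) → t.toFun 0 = y →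
      t.Cofinal r ∨ t.Cofinal s := by
    intro y y' hy
    refine huv.induction (P := fun y => ∀ t : T.Ray,
      (∀ n, IsEssential ρ (t.toFun n) (t.toFun (n + 1))) → t.toFun 0 = y →
      t.Cofinal r ∨ t.Cofinal s) hT hy ?_ ?_
    · intro t ht ht0
      by_cases ht1 : t.toFun 1 = v
      · exact Or.inl (huniq t r ht hr (ht0.trans hr0.symm) (ht1.trans hr1.symm))
      · right
        refine Ray.cofinal_equivalence.trans
          (huniq t s.tail ht (fun n => hs (n + 1)) (ht0.trans hs1.symm) ?_) s.tail_cofinal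
        have h1 : IsEssential ρ u (t.toFun 1) := ht0 ▸ ht 0
        have h2 : IsEssential ρ u (s.toFun 2) := hs1 ▸ hs 1
        exact htwo u v _ _ huv h1 h2 (Ne.symm ht1) (hs0 ▸ (s.ne_add_two 0).symm)
    · intro a b hab ih t ht ht0
      by_cases ht1 : t.toFun 1 = a
      · have hc := Ray.cofinal_equivalence.symm t.tail_cofinal
        exact (ih t.tail (fun n => ht (n + 1)) ht1).imp
          (Ray.cofinal_equivalence.trans hc) (Ray.cofinal_equivalence.trans hc)
      · have hadj : T.Adj a (t.toFun 0) := ht0.symm ▸ hab.adj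
        have hc := t.cofinal_cons hT a hadj ht1
        refine (ih (t.cons hT a hadj ht1) ?_ rfl).imp
          (Ray.cofinal_equivalence.trans hc) (Ray.cofinal_equivalence.trans hc)
        intro n
        cases n with
        | zero =>
          change IsEssential ρ a (t.toFun 0)
          rwa [ht0]
        | succ n => exact ht n
  let a : T.TreeEnd := Quotient.mk _ r
  let b : T.TreeEnd := Quotient.mk _ s
  have hab : a ≠ b := by
    intro h
    obtain ⟨i, j, hij⟩ : r.Cofinal s := Quotient.exact h
    have h1 := r.mem_halfTree hT i
    have h2 := s.mem_halfTree hT j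
    rw [hr0, hr1, hij 1] at h1
    rw [hs0, hs1, ← hT.notMem_halfTree huv.adj] at h2
    exact h2 h1
  have hmaps : ∀ g, ∀ e ∈ ({a, b} : Set T.TreeEnd), TreeEnd.map (ρ g) e ∈ ({a, b} : Set _) := by
    have aux : ∀ (g : G) (t : T.Ray), (∀ n, IsEssential ρ (t.toFun n) (t.toFun (n + 1))) →
        TreeEnd.map (ρ g) (Quotient.mk _ t) ∈ ({a, b} : Set T.TreeEnd) := by
      intro g t ht
      have ht' : ∀ n, IsEssential ρ ((t.map (ρ g)).toFun n) ((t.map (ρ g)).toFun (n + 1)) :=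
        fun n => (ht n).map hT g
      rcases hall _ _ (ht' 0) (t.map (ρ g)) ht' rfl with h | h
      · exact Or.inl (Quotient.sound h)
      · exact Or.inr (Quotient.sound h)
    rintro g e (rfl | rfl)
    · exact aux g r hr
    · exact aux g s hs
  refine no_fixed_pair_of_ends ⟨a, b, hab, fun g => Set.Subset.antisymm ?_ ?_⟩
  · rintro _ ⟨e, he, rfl⟩
    exact hmaps g e he
  · intro e he
    refine ⟨_, hmaps g⁻¹ e he, ?_⟩
    induction e using Quotient.inductionOn with
    | h t =>
      refine Quotient.sound ⟨0, 0, fun n => ?_⟩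
      exact map_apply_inv_self ρ g _

/-! ### The subtree of essential edges -/

/-- The subgraph formed by the essential edges. -/
def essentialSubgraph (ρ : G →* (T ≃g T)) : T.Subgraph where
  verts := {x | ∃ y, IsEssential ρ x y}
  Adj := IsEssential ρ
  adj_sub h := h.adj
  edge_vert h := ⟨_, h⟩
  symm := ⟨fun _ _ h => h.symm⟩

theorem IsTree.isInvariantSubtree_essentialSubgraph (hT : T.IsTree) {u v : V}
    (huv : IsEssential ρ u v) : IsInvariantSubtree ρ (essentialSubgraph ρ) where
  isTree := by
    refine ⟨?_, hT.isAcyclic.subgraph _⟩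
    have hu : u ∈ (essentialSubgraph ρ).verts := ⟨v, huv⟩
    rw [connected_iff_exists_forall_reachable]
    refine ⟨⟨u, hu⟩, fun ⟨y, hy⟩ => ?_⟩
    have hy₀ := hy
    obtain ⟨y', hy'⟩ := hy₀
    refine huv.induction hT (P := fun y => ∀ hy : y ∈ (essentialSubgraph ρ).verts,
      (essentialSubgraph ρ).coe.Reachable ⟨u, hu⟩ ⟨y, hy⟩) hy' (fun _ => .rfl) ?_ hy
    intro a b hab ih hb
    refine (ih ⟨b, hab⟩).trans (Adj.reachable ?_)
    exact hab
  verts_mem := fun g _ ⟨_, h⟩ => ⟨_, h.map hT g⟩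
  adj g _ _ h := IsEssential.map hT h g

/-- An orbit in `S` meets both sides of an essential edge, and a path in `S` joining them must cross
that edge. -/
theorem IsTree.essentialSubgraph_le (hT : T.IsTree) {S : T.Subgraph}
    (hS : IsInvariantSubtree ρ S) : essentialSubgraph ρ ≤ S := by
  have hadj : ∀ u v, IsEssential ρ u v → S.Adj u v := by
    intro u v h
    obtain ⟨x, hx⟩ := hS.isTree.connected.nonempty
    obtain ⟨g, hg⟩ := h.right x
    obtain ⟨k, hk⟩ := h.left x
    obtain ⟨p⟩ := hS.isTree.connected ⟨_, hS.verts_mem g hx⟩ ⟨_, hS.verts_mem k hx⟩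
    obtain ⟨d, -, h1, h2⟩ := p.exists_boundary_dart (Subtype.val ⁻¹' T.halfTree u v) hg
      ((hT.notMem_halfTree h.adj).2 hk)
    have hd : S.Adj d.fst d.snd := d.adj
    obtain ⟨e1, e2⟩ := hT.eq_of_mem_halfTree_of_notMem h.adj hd.adj_sub h1 h2
    rw [e1, e2] at hd
    exact hd.symm
  exact ⟨fun x ⟨y, h⟩ => (hadj x y h).fst_mem, fun {u v} h => hadj u v h⟩

/-! ### Conjugation invariant means -/

/-- The elements that move the vertex `u` farther than the vertex `v`. -/
def approachSet (ρ : G →* (T ≃g T)) (u v : V) : Set G :=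
  {g | T.dist v (ρ g v) < T.dist u (ρ g u)}

theorem Connected.image_conj_approachSet (hT : T.Connected) (ρ : G →* (T ≃g T)) (k : G) (u v : V) :
    (fun h => k * h * k⁻¹) '' approachSet ρ u v = approachSet ρ (ρ k u) (ρ k v) := by
  have key : ∀ g, k * g * k⁻¹ ∈ approachSet ρ (ρ k u) (ρ k v) ↔ g ∈ approachSet ρ u v := by
    intro g
    simp only [approachSet, Set.mem_ofPred_eq, map_mul_apply, map_inv_apply_self, Iso.dist_eq hT]
  ext g
  constructor
  · rintro ⟨h, hh, rfl⟩
    exact (key h).2 hh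
  · intro hg
    refine ⟨k⁻¹ * g * k, (key _).1 ?_, by group⟩
    convert hg using 1
    group

/-- Displacement that grows from `q` to `p` still grows from `v` to `u`, further out on the same
path. -/
theorem IsTree.approachSet_subset (hT : T.IsTree) {u v p q : V} (huv : T.Adj u v)
    (hpq : T.Adj p q) (h : T.halfTree p q ⊆ T.halfTree u v) :
    approachSet ρ p q ⊆ approachSet ρ u v := fun g hg =>
  hT.displacement_lt_of_halfTree (ρ g) hpq huv.symm hg
    ((hT.notMem_halfTree huv.symm).2 (h (right_mem_halfTree hpq)))
    (fun hu => left_notMem_halfTree (h hu))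

theorem IsTree.disjoint_approachSet (hT : T.IsTree) {u v p q : V} (huv : T.Adj u v)
    (hpq : T.Adj p q) (h : Disjoint (T.halfTree u v) (T.halfTree p q)) :
    Disjoint (approachSet ρ u v) (approachSet ρ p q) := by
  refine Set.disjoint_left.2 fun g hg hg' => ?_
  exact lt_asymm hg' (hT.displacement_lt_of_halfTree (ρ g) huv hpq hg
    (Set.disjoint_left.1 h (right_mem_halfTree huv))
    (Set.disjoint_right.1 h (right_mem_halfTree hpq)))

/-- Translate the half-tree into the branches at `c` through `a 1` and `a 2`, then move everything
outside the branch through `a 0` into the half-tree by `g`. The two disjoint copies have equal mean.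
-/
theorem IsEssential.mean_approachSet_eq_zero (hT : T.IsTree)
    (no_fixed_vertex : ¬ ∃ x : V, ∀ g : G, ρ g x = x)
    (no_fixed_end : ¬ ∃ a : T.TreeEnd, ∀ g : G, TreeEnd.map (ρ g) a = a)
    {c : V} {a : Fin 3 → V} (ha : Function.Injective a) (hc : ∀ i, IsEssential ρ c (a i))
    {m : Mean G} (hm : m.ConjInvariant) {u v : V} (h : IsEssential ρ u v) :
    m.toFun (approachSet ρ u v) = 0 := by
  have hconj : ∀ k, m.toFun (approachSet ρ (ρ k u) (ρ k v)) = m.toFun (approachSet ρ u v) :=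
    fun k => by rw [← hT.connected.image_conj_approachSet, hm]
  obtain ⟨g, hg⟩ := (hc 0).symm.exists_subset hT no_fixed_vertex no_fixed_end h
  obtain ⟨k, hk⟩ := h.exists_subset hT no_fixed_vertex no_fixed_end (hc 1)
  obtain ⟨l, hl⟩ := h.exists_subset hT no_fixed_vertex no_fixed_end (hc 2)
  have hd : ∀ i j, i ≠ j → Disjoint (T.halfTree c (a i)) (T.halfTree c (a j)) := fun i j hij =>
    hT.disjoint_halfTree_of_ne (hc i).adj (hc j).adj (ha.ne hij)
  have hsub : ∀ i, i ≠ 0 → ∀ k, T.halfTree (ρ k u) (ρ k v) ⊆ T.halfTree c (a i) →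
      T.halfTree (ρ (g * k) u) (ρ (g * k) v) ⊆ T.halfTree u v := by
    intro i hi k hk
    rw [map_mul_apply, map_mul_apply]
    refine ((Iso.halfTree_subset_iff hT.connected _).2 (hk.trans ?_)).trans hg
    exact (hT.disjoint_halfTree_iff (hc 0).adj).1 (hd i 0 hi)
  have hdisj : Disjoint (approachSet ρ (ρ (g * k) u) (ρ (g * k) v))
      (approachSet ρ (ρ (g * l) u) (ρ (g * l) v)) := by
    refine hT.disjoint_approachSet (h.map hT _).adj (h.map hT _).adj ?_
    simp only [map_mul_apply]
    rw [Iso.disjoint_halfTree_iff hT.connected]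
    exact (hd 1 2 (by decide)).mono hk hl
  have hle := m.mono (Set.union_subset
    (hT.approachSet_subset (ρ := ρ) h.adj (h.map hT _).adj (hsub 1 (by decide) k hk))
    (hT.approachSet_subset (ρ := ρ) h.adj (h.map hT _).adj (hsub 2 (by decide) l hl)))
  rw [m.union _ _ hdisj, hconj, hconj] at hle
  have := m.nonneg (approachSet ρ u v)
  linarith

theorem IsEssential.mean_displacement_ne_eq_zero {m : Mean G} {u v : V}
    (h : m.toFun (approachSet ρ u v) = 0) (h' : m.toFun (approachSet ρ v u) = 0) :
    m.toFun {g | T.dist u (ρ g u) ≠ T.dist v (ρ g v)} = 0 :=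
  m.eq_zero_of_subset (fun _ hg => (lt_or_gt_of_ne hg).symm) (m.union_eq_zero h h')

end SimpleGraph

open SimpleGraph

theorem theorem1p3 {G : Type u} [Group G] {V : Type v} (T : SimpleGraph V) (hT : T.IsTree)
    (ρ : G →* (T ≃g T))
    (no_fixed_vertex : ¬ ∃ x : V, ∀ g : G, ρ g x = x)
    (no_fixed_edge : ¬ ∃ e ∈ T.edgeSet, ∀ g : G, Sym2.map (ρ g) e = e)
    (no_fixed_end : ¬ ∃ a : T.TreeEnd, ∀ g : G, SimpleGraph.TreeEnd.map (ρ g) a = a)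
    (no_fixed_pair_of_ends : ¬ ∃ a b : T.TreeEnd, a ≠ b ∧
      ∀ g : G, SimpleGraph.TreeEnd.map (ρ g) '' {a, b} = {a, b}) :
    ∃ T₀ : T.Subgraph,
      T₀.verts.Nonempty ∧
      IsLeast {S : T.Subgraph | SimpleGraph.IsInvariantSubtree ρ S} T₀ ∧
      ∀ m : Mean G, m.ConjInvariant →
        ∀ x ∈ T₀.verts, m.toFun {g : G | ρ g x = x} = 1 := by
  obtain ⟨c, a, ha, hc⟩ := hT.exists_three_essential no_fixed_vertex no_fixed_edge no_fixed_end
    no_fixed_pair_of_ends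
  refine ⟨essentialSubgraph ρ, ⟨c, _, hc 0⟩,
    ⟨hT.isInvariantSubtree_essentialSubgraph (hc 0), fun _ hS => hT.essentialSubgraph_le hS⟩, ?_⟩
  rintro m hm x ⟨x', hx⟩
  have hzero : ∀ u v, IsEssential ρ u v →
      m.toFun {g | T.dist u (ρ g u) ≠ T.dist v (ρ g v)} = 0 := fun u v h =>
    IsEssential.mean_displacement_ne_eq_zero
      (h.mean_approachSet_eq_zero hT no_fixed_vertex no_fixed_end ha hc hm)
      (h.symm.mean_approachSet_eq_zero hT no_fixed_vertex no_fixed_end ha hc hm)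
  refine m.eq_one_of_compl ((hc 0).induction hT
    (P := fun y => m.toFun {g : G | ρ g y = y}ᶜ = 0) hx ?_ ?_)
  -- Outside three null sets, `c` and its three neighbours have equal displacement.
  · refine m.eq_zero_of_subset ?_ (m.union_eq_zero (hzero _ _ (hc 0))
      (m.union_eq_zero (hzero _ _ (hc 1)) (hzero _ _ (hc 2))))
    intro g hg
    by_contra hcon
    simp only [Set.mem_union, Set.mem_ofPred_eq, not_or, not_not] at hcon
    refine hg (hT.apply_eq_of_three_neighbors (ρ g) ha (fun i => (hc i).adj) fun i => ?_)
    fin_cases i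
    exacts [hcon.1.symm, hcon.2.1.symm, hcon.2.2.symm]
  -- If `y` is fixed and `z` has the same displacement, that displacement is 0.
  · intro y z hyz hy
    refine m.eq_zero_of_subset ?_ (m.union_eq_zero hy (hzero _ _ hyz))
    intro g hg
    by_contra hcon
    simp only [Set.mem_union, Set.mem_compl_iff, Set.mem_ofPred_eq, not_or, not_not] at hcon
    obtain ⟨h1, h2⟩ := hcon
    rw [h1, dist_self] at h2
    exact hg (hT.connected.dist_eq_zero_iff.1 h2.symm).symm
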